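/- Let $K$ be a commutative $\mathbb{Q}$-algebra, let $s,t\in K$, and put $\alpha=s+t$, $\beta=st$. Let $\mathbf{Sym}=K\langle S_1,S_2,\ldots\rangle$ be the algebra of noncommutative symmetric functions, $\sigma_1=1+\sum_{n\ge1}S_n$ (with $\deg S_n=n$), and $\varphi=\log\sigma_1$. Let $$f(x)=\frac{e^{sx}-e^{tx}}{s\,e^{tx}-t\,e^{sx}}\in K[[x]]$$ (numerator and denominator being first divided by $s-t$, so that $f$ is also defined for $s=t$), let $Y_n$ be the component of degree $n$ of $Y=f(\varphi)$, and for a composition $I=(i_1,\ldots,i_r)$ let $Y^I=Y_{i_1}\cdots Y_{i_r}$. The $Y^I$ form a basis of $\mathbf{Sym}$. Let $(X_I)$ be its dual basis in the algebra $QSym$ of quasi-symmetric functions over $K$, with respect to the pairing $\langle M_I,S^J\rangle=\delta_{I,J}$, where $M_I$ are the monomial quasi-symmetric functions and $S^J=S_{j_1}\cdots S_{j_k}$. For a composition $I$, let $\ell_0(I)$ be its number of even parts and $\ell_1(I)$ its number of odd parts. Then for all integers $p,q\ge 0$, $$X_{1^p}X_{1^q}=\sum_{I\vDash p+q}\binom{\ell_1(I)}{p-\frac{p+q-\ell_1(I)}{2}}\,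 \alpha^{\ell_0(I)}\,\beta^{\frac{p+q-\ell_1(I)}{2}-\ell_0(I)}\,X_I ,$$ where the sum is over all compositions $I$ of $p+q$, $1^p$ is the composition of $p$ with $p$ parts equal to $1$, and a binomial coefficient with negative lower entry is $0$. -/

import Mathlib

open Module

noncomputable section

namespace NCSF

variable {K : Type*} [CommRing K]

/-- The product `Z^I = Z_{i_1} Z_{i_2} ⋯ Z_{i_r}` attached to a word `I = i_1 i_2 ⋯ i_r` over the
positive integers and a sequence `Z_1, Z_2, …` of elements of the algebra of noncommutative
symmetric functions. That algebra is the free associative algebra on the complete functions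
`S_n = FreeAlgebra.ι K n`, `n ≥ 1`. -/
def wordProd (Z : ℕ+ → FreeAlgebra K ℕ+) (I : FreeMonoid ℕ+) : FreeAlgebra K ℕ+ :=
  (I.toList.map Z).prod

/-- The complete function `S_n`, with `S_0 = 1`. -/
def complete (K : Type*) [CommRing K] (n : ℕ) : FreeAlgebra K ℕ+ :=
  if h : 0 < n then FreeAlgebra.ι K (n.toPNat h) else 1

/-- The generating series `σ_z = ∑_{n ≥ 0} S_n z^n`; the central variable `z` records the degree. -/
def sigma (K : Type*) [CommRing K] : PowerSeries (FreeAlgebra K ℕ+) :=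
  PowerSeries.mk (complete K)

/-- The composition `c(g) = ∑_k c_k g^k` of a power series `c` with scalar coefficients and a power
series `g` over a noncommutative algebra, where `g` has no constant term
(so that only the terms with `k ≤ n` contribute to the coefficient of `z^n`). -/
def comp {A : Type*} [Ring A] [Algebra K A] (c : PowerSeries K) (g : PowerSeries A) :
    PowerSeries A :=
  PowerSeries.mk fun n =>
    ∑ k ∈ Finset.range (n + 1), PowerSeries.coeff k c • PowerSeries.coeff n (g ^ k)

variable [Algebra ℚ K]

/-- `φ = log σ_z = ∑_{n ≥ 1} φ_n z^n`. -/
def phi (K : Type*) [CommRing K] [Algebra ℚ K] : PowerSeries (FreeAlgebra K ℕ+) :=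
  comp (PowerSeries.log K) (sigma K - 1)

/-- The series `(e^{sx} - e^{tx}) / (s - t)`, written without a division by `s - t`:
the coefficient of `x^n` is `(s^{n-1} + s^{n-2} t + ⋯ + t^{n-1}) / n!`. -/
def expDiff (s t : K) : PowerSeries K :=
  PowerSeries.mk fun n =>
    algebraMap ℚ K (1 / (n.factorial : ℚ)) * ∑ i ∈ Finset.range n, s ^ i * t ^ (n - 1 - i)

/-- The series `f(x) = (e^{sx} - e^{tx}) / (s e^{tx} - t e^{sx})`. Numerator and denominator have been
divided by `s - t`, so that the definition makes sense (by continuity) also for `s = t`;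
the denominator becomes `e^{sx} - s (e^{sx} - e^{tx}) / (s - t)`, whose constant term is `1`. -/
def fSeries (s t : K) : PowerSeries K :=
  expDiff s t *
    PowerSeries.invOfUnit (PowerSeries.rescale s (PowerSeries.exp K) - PowerSeries.C s * expDiff s t) 1

theorem expDiff_mul (s t : K) :
    PowerSeries.C (s - t) * expDiff s t =
      PowerSeries.rescale s (PowerSeries.exp K) - PowerSeries.rescale t (PowerSeries.exp K) := by
  ext n
  have h := (Commute.all s t).mul_geom_sum₂ n
  rw [PowerSeries.coeff_C_mul, map_sub, PowerSeries.coeff_rescale, PowerSeries.coeff_rescale,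
    PowerSeries.coeff_exp, ← sub_mul, ← h, expDiff, PowerSeries.coeff_mk]
  ring

theorem fSeries_mul_aux (s t : K) :
    fSeries s t *
      (PowerSeries.rescale s (PowerSeries.exp K) - PowerSeries.C s * expDiff s t) =
      expDiff s t := by
  have h := PowerSeries.mul_invOfUnit
    (PowerSeries.rescale s (PowerSeries.exp K) - PowerSeries.C s * expDiff s t) 1 (by
      rw [← PowerSeries.coeff_zero_eq_constantCoeff_apply, map_sub, PowerSeries.coeff_rescale,
        PowerSeries.coeff_C_mul, expDiff, PowerSeries.coeff_mk, PowerSeries.coeff_exp]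
      simp)
  rw [fSeries, mul_assoc, mul_comm (PowerSeries.invOfUnit _ _), h, mul_one]

/-- The defining equation `f(x) (s e^{tx} - t e^{sx}) = e^{sx} - e^{tx}`. -/
theorem fSeries_mul (s t : K) :
    fSeries s t * (PowerSeries.C s * PowerSeries.rescale t (PowerSeries.exp K) -
        PowerSeries.C t * PowerSeries.rescale s (PowerSeries.exp K)) =
      PowerSeries.rescale s (PowerSeries.exp K) - PowerSeries.rescale t (PowerSeries.exp K) := by
  have h1 := expDiff_mul s t
  have h2 := fSeries_mul_aux s t
  rw [map_sub] at h1
  linear_combination (PowerSeries.C s - PowerSeries.C t) * h2 + (1 + fSeries s t * PowerSeries.C s) * h1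

theorem coeff_one_fSeries (s t : K) : PowerSeries.coeff 1 (fSeries s t) = 1 := by
  have h := congrArg (PowerSeries.coeff 1) (fSeries_mul_aux s t)
  have h0 : PowerSeries.coeff 0 (fSeries s t) = 0 := by
    have h := congrArg (PowerSeries.coeff 0) (fSeries_mul_aux s t)
    simpa [expDiff, PowerSeries.coeff_mul, PowerSeries.coeff_rescale] using h
  rw [PowerSeries.coeff_mul, Finset.Nat.antidiagonal_succ] at h
  simp [PowerSeries.coeff_rescale, h0, expDiff] at h
  simpa [h0, expDiff] using h

/-- `Y_n` is the component of degree `n` of `Y = f(φ)`. -/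
def Y (s t : K) (n : ℕ+) : FreeAlgebra K ℕ+ :=
  PowerSeries.coeff (n : ℕ) (comp (fSeries s t) (phi K))

/-- The span of the `S^I` where `I` has sum `m` and all parts `< N`. -/
def partSpan (K : Type*) [CommRing K] (N m : ℕ) : Submodule K (FreeAlgebra K ℕ+) :=
  Submodule.span K {x | ∃ I : FreeMonoid ℕ+, (∀ a ∈ I.toList, (a : ℕ) < N) ∧
    (I.toList.map PNat.val).sum = m ∧ x = wordProd (FreeAlgebra.ι K) I}

/-- The span of the `Z^I` where `I` has sum `m`. -/
def sumSpan (Z : ℕ+ → FreeAlgebra K ℕ+) (m : ℕ) : Submodule K (FreeAlgebra K ℕ+) :=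
  Submodule.span K {x | ∃ I : FreeMonoid ℕ+, (I.toList.map PNat.val).sum = m ∧ x = wordProd Z I}

section Triangularity

variable {R : Type*} [CommRing R]

theorem wordProd_mul (Z : ℕ+ → FreeAlgebra R ℕ+) (I J : FreeMonoid ℕ+) :
    wordProd Z (I * J) = wordProd Z I * wordProd Z J := by
  simp [wordProd]

theorem mul_mem_partSpan {N i j : ℕ} {x y : FreeAlgebra R ℕ+} (hx : x ∈ partSpan R N i)
    (hy : y ∈ partSpan R N j) : x * y ∈ partSpan R N (i + j) := by
  have h := Submodule.mul_mem_mul hx hy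
  rw [partSpan, partSpan, Submodule.span_mul_span] at h
  refine Submodule.span_mono ?_ h
  rintro _ ⟨_, ⟨I, hI, hI', rfl⟩, _, ⟨J, hJ, hJ', rfl⟩, rfl⟩
  refine ⟨I * J, ?_, ?_, (wordProd_mul _ _ _).symm⟩
  · intro a ha
    rw [FreeMonoid.toList_mul, List.mem_append] at ha
    exact ha.elim (hI a) (hJ a)
  · rw [FreeMonoid.toList_mul, List.map_append, List.sum_append, hI', hJ']

theorem mul_mem_sumSpan {Z : ℕ+ → FreeAlgebra R ℕ+} {i j : ℕ} {x y : FreeAlgebra R ℕ+}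
    (hx : x ∈ sumSpan Z i) (hy : y ∈ sumSpan Z j) : x * y ∈ sumSpan Z (i + j) := by
  have h := Submodule.mul_mem_mul hx hy
  rw [sumSpan, sumSpan, Submodule.span_mul_span] at h
  refine Submodule.span_mono ?_ h
  rintro _ ⟨_, ⟨I, hI', rfl⟩, _, ⟨J, hJ', rfl⟩, rfl⟩
  refine ⟨I * J, ?_, (wordProd_mul _ _ _).symm⟩
  rw [FreeMonoid.toList_mul, List.map_append, List.sum_append, hI', hJ']

theorem one_mem_partSpan (N : ℕ) : (1 : FreeAlgebra R ℕ+) ∈ partSpan R N 0 :=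
  Submodule.subset_span ⟨1, by simp, by simp, by simp [wordProd]⟩

theorem one_mem_sumSpan (Z : ℕ+ → FreeAlgebra R ℕ+) : (1 : FreeAlgebra R ℕ+) ∈ sumSpan Z 0 :=
  Submodule.subset_span ⟨1, by simp, by simp [wordProd]⟩

theorem partSpan_mono {N N' : ℕ} (h : N ≤ N') (m : ℕ) : partSpan R N m ≤ partSpan R N' m := by
  refine Submodule.span_mono ?_
  rintro _ ⟨I, hI, hI', rfl⟩
  exact ⟨I, fun a ha => (hI a ha).trans_le h, hI', rfl⟩

theorem coeff_pow_mem {g : PowerSeries (FreeAlgebra R ℕ+)}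
    (hg : ∀ m, PowerSeries.coeff m g ∈ partSpan R (m + 1) m) (k n : ℕ) :
    PowerSeries.coeff n (g ^ k) ∈ partSpan R (n + 1) n := by
  induction k generalizing n with
  | zero =>
    rw [pow_zero, PowerSeries.coeff_one]
    split_ifs with h
    · subst h
      exact one_mem_partSpan _
    · exact zero_mem _
  | succ k ih =>
    rw [pow_succ, PowerSeries.coeff_mul]
    refine Submodule.sum_mem _ fun p hp => ?_
    rw [Finset.HasAntidiagonal.mem_antidiagonal] at hp
    have h := mul_mem_partSpan (partSpan_mono (by omega : p.1 + 1 ≤ n + 1) _ (ih p.1))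
      (partSpan_mono (by omega : p.2 + 1 ≤ n + 1) _ (hg p.2))
    rwa [hp] at h

theorem coeff_pow_mem' {g : PowerSeries (FreeAlgebra R ℕ+)} (h0 : PowerSeries.coeff 0 g = 0)
    (hg : ∀ m, PowerSeries.coeff m g ∈ partSpan R (m + 1) m) (k n : ℕ) :
    PowerSeries.coeff n (g ^ (k + 2)) ∈ partSpan R n n := by
  rw [pow_succ, PowerSeries.coeff_mul]
  refine Submodule.sum_mem _ fun p hp => ?_
  rw [Finset.HasAntidiagonal.mem_antidiagonal] at hp
  rcases Nat.eq_zero_or_pos p.1 with h1 | h1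
  · rw [h1, pow_succ, PowerSeries.coeff_mul]
    simp [h0]
  rcases Nat.eq_zero_or_pos p.2 with h2 | h2
  · simp [h2, h0]
  have h := mul_mem_partSpan
    (partSpan_mono (by omega : p.1 + 1 ≤ n) _ (coeff_pow_mem hg (k + 1) p.1))
    (partSpan_mono (by omega : p.2 + 1 ≤ n) _ (hg p.2))
  rwa [hp] at h

theorem coeff_comp_sub_mem {c : PowerSeries R} (hc : PowerSeries.coeff 1 c = 1)
    {g : PowerSeries (FreeAlgebra R ℕ+)} (h0 : PowerSeries.coeff 0 g = 0)
    (hg : ∀ m, PowerSeries.coeff m g ∈ partSpan R (m + 1) m) {n : ℕ} (hn : 0 < n) :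
    PowerSeries.coeff n (comp c g) - PowerSeries.coeff n g ∈ partSpan R n n := by
  obtain ⟨n, rfl⟩ := Nat.exists_eq_succ_of_ne_zero hn.ne'
  rw [comp, PowerSeries.coeff_mk, Finset.sum_range_succ', Finset.sum_range_succ']
  simp only [pow_zero, zero_add, pow_one, hc, one_smul, PowerSeries.coeff_one, Nat.succ_ne_zero,
    if_false, smul_zero, add_zero, Nat.succ_eq_add_one, add_sub_cancel_right]
  exact Submodule.sum_mem _ fun k _ => Submodule.smul_mem _ _ (coeff_pow_mem' h0 hg k _)

theorem coeff_comp_mem {c : PowerSeries R} (hc : PowerSeries.coeff 1 c = 1)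
    (hc0 : PowerSeries.coeff 0 c = 0)
    {g : PowerSeries (FreeAlgebra R ℕ+)} (h0 : PowerSeries.coeff 0 g = 0)
    (hg : ∀ m, PowerSeries.coeff m g ∈ partSpan R (m + 1) m) (n : ℕ) :
    PowerSeries.coeff n (comp c g) ∈ partSpan R (n + 1) n := by
  rcases Nat.eq_zero_or_pos n with rfl | hn
  · simp [comp, hc0]
  · have h := Submodule.add_mem _
      (partSpan_mono n.le_succ n (coeff_comp_sub_mem hc h0 hg hn)) (hg n)
    rwa [sub_add_cancel] at h

theorem coeff_sigma_mem (m : ℕ) :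
    PowerSeries.coeff m (sigma R - 1) ∈ partSpan R (m + 1) m := by
  rw [map_sub, sigma, PowerSeries.coeff_mk, PowerSeries.coeff_one, complete]
  split_ifs with h h'
  · omega
  · have hv : ((m.toPNat h : ℕ+) : ℕ) = m := rfl
    rw [sub_zero]
    exact Submodule.subset_span ⟨FreeMonoid.of (m.toPNat h), by simp [hv], by simp [hv], by simp [wordProd]⟩
  · simp
  · omega

theorem coeff_sigma_zero : PowerSeries.coeff 0 (sigma R - 1) = 0 := by
  rw [map_sub, sigma, PowerSeries.coeff_mk, PowerSeries.coeff_one, complete]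
  simp

/-- A triangular family `Z_n ∈ S_n + (products of S_m, m < n, of degree n)`. -/
theorem complete_mem_sumSpan {Z : ℕ+ → FreeAlgebra R ℕ+}
    (hZ : ∀ n : ℕ+, Z n - FreeAlgebra.ι R n ∈ partSpan R n n) (n : ℕ+) :
    FreeAlgebra.ι R n ∈ sumSpan Z n := by
  induction n using PNat.strongInductionOn with
  | _ n ih =>
    have key : partSpan R n n ≤ sumSpan Z n := by
      refine Submodule.span_le.2 ?_
      rintro _ ⟨I, hI, hI', rfl⟩
      rw [← hI']
      clear hI'
      induction I using FreeMonoid.inductionOn' with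
      | one => exact one_mem_sumSpan Z
      | of_mul a I ihI =>
        rw [FreeMonoid.toList_of_mul, List.map_cons, List.sum_cons, wordProd_mul]
        refine mul_mem_sumSpan ?_ (ihI fun b hb => hI b (by simp [hb]))
        simpa [wordProd] using ih a (by simpa using hI a (by simp))
    have h : Z n ∈ sumSpan Z n :=
      Submodule.subset_span ⟨FreeMonoid.of n, by simp, by simp [wordProd]⟩
    have := Submodule.sub_mem _ h (key (hZ n))
    rwa [sub_sub_cancel] at this

theorem wordProd_mem_sumSpan {Z : ℕ+ → FreeAlgebra R ℕ+}
    (hZ : ∀ n : ℕ+, Z n - FreeAlgebra.ι R n ∈ partSpan R n n) (I : FreeMonoid ℕ+) :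
    wordProd (FreeAlgebra.ι R) I ∈ sumSpan Z (I.toList.map PNat.val).sum := by
  induction I using FreeMonoid.inductionOn' with
  | one => exact one_mem_sumSpan Z
  | of_mul a I ihI =>
    rw [FreeMonoid.toList_of_mul, List.map_cons, List.sum_cons, wordProd_mul]
    refine mul_mem_sumSpan ?_ ihI
    simpa [wordProd] using complete_mem_sumSpan hZ a

theorem lift_wordProd (Z W : ℕ+ → FreeAlgebra R ℕ+) (I : FreeMonoid ℕ+) :
    FreeAlgebra.lift R Z (wordProd W I) = wordProd (fun n => FreeAlgebra.lift R Z (W n)) I := by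
  simp [wordProd, map_list_prod, Function.comp_def]

/-- The left inverse of a triangular change of generators. -/
def triInv (Z : ℕ+ → FreeAlgebra R ℕ+) (n : ℕ+) : FreeAlgebra R ℕ+ :=
  FreeAlgebra.ι R n - FreeAlgebra.lift R
    (fun m => if _ : m < n then triInv Z m else 0) (Z n - FreeAlgebra.ι R n)
termination_by n

theorem lift_bijective {Z : ℕ+ → FreeAlgebra R ℕ+}
    (hZ : ∀ n : ℕ+, Z n - FreeAlgebra.ι R n ∈ partSpan R n n) :
    Function.Bijective (FreeAlgebra.lift R Z) := by
  constructor
  · have h : ∀ n, FreeAlgebra.lift R (triInv Z) (Z n) = FreeAlgebra.ι R n := by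
      intro n
      have h1 : ∀ x ∈ partSpan R n n, FreeAlgebra.lift R (triInv Z) x =
          FreeAlgebra.lift R (fun m => if _ : m < n then triInv Z m else 0) x := by
        intro x hx
        refine Submodule.span_induction ?_ (by simp) (fun x y _ _ hx hy => by simp [hx, hy])
          (fun a x _ hx => by simp [hx]) hx
        rintro _ ⟨I, hI, -, rfl⟩
        rw [lift_wordProd, lift_wordProd, wordProd, wordProd]
        congr 1
        refine List.map_congr_left fun a ha => ?_
        have : a < n := by simpa using hI a ha
        simp [this]
      have h2 := h1 _ (hZ n)
      rw [map_sub, FreeAlgebra.lift_ι_apply] at h2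
      rw [triInv] at h2
      rw [sub_eq_iff_eq_add] at h2
      rw [h2]
      abel
    have h' : (FreeAlgebra.lift R (triInv Z)).comp (FreeAlgebra.lift R Z) = AlgHom.id R _ := by
      refine FreeAlgebra.hom_ext (funext fun n => ?_)
      simp [h]
    exact Function.LeftInverse.injective fun x => DFunLike.congr_fun h' x
  · rw [← AlgHom.range_eq_top, eq_top_iff, ← FreeAlgebra.adjoin_range_ι, Algebra.adjoin_le_iff]
    rintro _ ⟨n, rfl⟩
    refine Submodule.span_le (p := Subalgebra.toSubmodule (FreeAlgebra.lift R Z).range).2 ?_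
      (complete_mem_sumSpan hZ n)
    rintro _ ⟨I, -, rfl⟩
    exact ⟨wordProd (FreeAlgebra.ι R) I, by simp [lift_wordProd]⟩

theorem basisFreeMonoid_eq (I : FreeMonoid ℕ+) :
    FreeAlgebra.basisFreeMonoid R ℕ+ I = wordProd (FreeAlgebra.ι R) I := by
  have h : FreeAlgebra.equivMonoidAlgebraFreeMonoid (wordProd (FreeAlgebra.ι R) I) =
      MonoidAlgebra.single I (1 : R) := by
    induction I using FreeMonoid.inductionOn' with
    | one => simp [wordProd, MonoidAlgebra.one_def]
    | of_mul a I ih =>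
      rw [wordProd_mul, map_mul, ih]
      simp [wordProd, FreeAlgebra.equivMonoidAlgebraFreeMonoid, MonoidAlgebra.single_mul_single]
  have h' := congrArg FreeAlgebra.equivMonoidAlgebraFreeMonoid.symm h
  rw [AlgEquiv.symm_apply_apply] at h'
  rw [h']
  rfl

end Triangularity

theorem Y_sub_mem (s t : K) (n : ℕ+) : Y s t n - FreeAlgebra.ι K n ∈ partSpan K n n := by
  have hl : PowerSeries.coeff 1 (PowerSeries.log K) = 1 := PowerSeries.coeff_one_log
  have hl0 : PowerSeries.coeff 0 (PowerSeries.log K) = 0 := by simp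
  have hφ : PowerSeries.coeff 0 (phi K) = 0 := by simp [phi, comp]
  have h1 := coeff_comp_sub_mem (coeff_one_fSeries s t) hφ
    (coeff_comp_mem hl hl0 coeff_sigma_zero coeff_sigma_mem) n.pos
  have h2 := coeff_comp_sub_mem hl coeff_sigma_zero coeff_sigma_mem n.pos
  have h3 := Submodule.add_mem _ h1 h2
  have h4 : PowerSeries.coeff (n : ℕ) (sigma K - 1) = FreeAlgebra.ι K n := by
    rw [map_sub, sigma, PowerSeries.coeff_mk, PowerSeries.coeff_one, complete]
    simp [n.pos]
    rfl
  rw [h4] at h3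
  rw [phi, sub_add_sub_cancel] at h3
  exact h3

/-- The basis `S^I` of the algebra of noncommutative symmetric functions. -/
def SBasis (K : Type*) [CommRing K] : Basis (FreeMonoid ℕ+) K (FreeAlgebra K ℕ+) :=
  FreeAlgebra.basisFreeMonoid K ℕ+

/-- The multiplicative basis `Y^I`: the image of the basis `S^I` under the automorphism
`S_n ↦ Y_n`. -/
def YBasis (s t : K) : Basis (FreeMonoid ℕ+) K (FreeAlgebra K ℕ+) :=
  (SBasis K).map
    (AlgEquiv.ofBijective (FreeAlgebra.lift K (Y s t)) (lift_bijective (Y_sub_mem s t))).toLinearEquiv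

theorem SBasis_apply {R : Type*} [CommRing R] (I : FreeMonoid ℕ+) : SBasis R I = wordProd (FreeAlgebra.ι R) I :=
  basisFreeMonoid_eq I

theorem YBasis_apply (s t : K) (I : FreeMonoid ℕ+) : YBasis s t I = wordProd (Y s t) I := by
  simp [YBasis, SBasis_apply, lift_wordProd]


theorem YBasis_repr_eq_zero (s t : K) (I J : FreeMonoid ℕ+)
    (h : (I.toList.map PNat.val).sum ≠ (J.toList.map PNat.val).sum) :
    (YBasis s t).repr (SBasis K J) I = 0 := by
  have hJ := wordProd_mem_sumSpan (Y_sub_mem s t) J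
  rw [← SBasis_apply] at hJ
  refine Submodule.span_induction ?_ (by simp) (fun x y _ _ hx hy => by simp [hx, hy])
    (fun a x _ hx => by simp [hx]) hJ
  rintro _ ⟨L, hL, rfl⟩
  classical
  rw [← YBasis_apply, Basis.repr_self, Finsupp.single_apply, if_neg]
  rintro rfl
  exact h hL

end NCSF

namespace QSym

variable {K : Type*} [CommRing K]

/-- The word of the nonzero exponents of a monomial in the variables `x_0, x_1, x_2, …`, read in
the order of the variables: `x_{k_1}^{i_1} ⋯ x_{k_r}^{i_r}` with `k_1 < ⋯ < k_r` and all
`i_j ≥ 1` gives `i_1 i_2 ⋯ i_r`. -/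
def exponentWord (m : ℕ →₀ ℕ) : FreeMonoid ℕ+ :=
  FreeMonoid.ofList ((m.support.sort (· ≤ ·)).map fun k => (m k).toPNat')

/-- The monomial `x_0^{i_1} x_1^{i_2} ⋯ x_{r-1}^{i_r}`. -/
def packedMonomial (I : FreeMonoid ℕ+) : ℕ →₀ ℕ :=
  (I.toList.map PNat.val).toFinsupp

/-- The module `QSym` of quasi-symmetric functions: the power series of bounded degree in which two
monomials have the same coefficient whenever they have the same exponent word. -/
def quasiSymm (K : Type*) [CommRing K] : Submodule K (MvPowerSeries ℕ K) where
  carrier := {F | (∃ d : ℕ, ∀ m : ℕ →₀ ℕ, d < m.degree → MvPowerSeries.coeff m F = 0) ∧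
    ∀ m m' : ℕ →₀ ℕ, exponentWord m = exponentWord m' →
      MvPowerSeries.coeff m F = MvPowerSeries.coeff m' F}
  zero_mem' := ⟨⟨0, by simp⟩, by simp⟩
  add_mem' := by
    rintro F G ⟨⟨d, hd⟩, hF⟩ ⟨⟨e, he⟩, hG⟩
    refine ⟨⟨max d e, fun m hm => ?_⟩, fun m m' h => ?_⟩
    · rw [map_add, hd m ((le_max_left _ _).trans_lt hm), he m ((le_max_right _ _).trans_lt hm),
        add_zero]
    · rw [map_add, map_add, hF m m' h, hG m m' h]
  smul_mem' := by
    rintro c F ⟨⟨d, hd⟩, hF⟩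
    refine ⟨⟨d, fun m hm => ?_⟩, fun m m' h => ?_⟩
    · rw [map_smul, hd m hm, smul_zero]
    · rw [map_smul, map_smul, hF m m' h]

/-- The pairing between quasi-symmetric functions and noncommutative symmetric functions:
`⟨F, S^I⟩` is the coefficient in `F` of `x_0^{i_1} ⋯ x_{r-1}^{i_r}`, that is the coefficient of `F`
on the monomial quasi-symmetric function `M_I`. -/
def pairing (F : MvPowerSeries ℕ K) : FreeAlgebra K ℕ+ →ₗ[K] K :=
  (NCSF.SBasis K).constr K fun I => MvPowerSeries.coeff (packedMonomial I) F

variable [Algebra ℚ K]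

/-- The dual basis `X_I` of the basis `Y^I`, as a power series: `X_I = ∑_J ⟨X_I, S^J⟩ M_J`, where
`⟨X_I, S^J⟩` is the coefficient of `Y^I` in the expansion of `S^J` on the basis `Y`, and the
monomials of `M_J` are those with exponent word `J`. -/
def X (s t : K) (I : FreeMonoid ℕ+) : MvPowerSeries ℕ K :=
  fun m => (NCSF.YBasis s t).repr (NCSF.SBasis K (exponentWord m)) I

/-- The word of the parts of a composition. -/
def wordOf {n : ℕ} (I : Composition n) : FreeMonoid ℕ+ :=
  FreeMonoid.ofList (I.blocks.map Nat.toPNat')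

/-- The number `ℓ₀(I)` of even parts. -/
def evenParts {n : ℕ} (I : Composition n) : ℕ := I.blocks.countP (fun i => Even i)

/-- The number `ℓ₁(I)` of odd parts. -/
def oddParts {n : ℕ} (I : Composition n) : ℕ := I.blocks.countP (fun i => Odd i)

/-- The binomial coefficient with an integer lower entry, equal to `0` if that entry is negative. -/
def binom (n : ℕ) (k : ℤ) : ℕ := if 0 ≤ k then n.choose k.toNat else 0

theorem exponentWord_packedMonomial (I : FreeMonoid ℕ+) : exponentWord (packedMonomial I) = I := by
  have hs : (packedMonomial I).support = Finset.range I.toList.length := by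
    ext k
    simp only [packedMonomial, Finsupp.mem_support_iff, List.toFinsupp_apply, Finset.mem_range]
    by_cases h : k < I.toList.length
    · simp [h]
    · simp [h]
  rw [exponentWord, hs, Finset.sort_range]
  refine FreeMonoid.toList.injective ?_
  rw [FreeMonoid.toList_ofList]
  refine List.ext_getElem (by simp) fun k h1 h2 => ?_
  simp [packedMonomial, h2]

theorem sum_exponentWord (m : ℕ →₀ ℕ) : ((exponentWord m).toList.map PNat.val).sum = m.degree := by
  have h : ∀ k ∈ m.support.sort (· ≤ ·), ((m k).toPNat' : ℕ) = m k := by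
    intro k hk
    rw [Finset.mem_sort, Finsupp.mem_support_iff] at hk
    simp [Nat.pos_of_ne_zero hk]
  have h' : (exponentWord m).toList.map PNat.val = (m.support.sort (· ≤ ·)).map m := by
    rw [exponentWord, FreeMonoid.toList_ofList, List.map_map]
    exact List.map_congr_left h
  rw [h', Finsupp.degree_apply]
  have h2 := List.sum_toFinset m (Finset.sort_nodup m.support (· ≤ ·))
  rw [Finset.sort_toFinset] at h2
  exact h2.symm

theorem pairing_X (s t : K) (I : FreeMonoid ℕ+) (U : FreeAlgebra K ℕ+) :
    pairing (X s t I) U = (NCSF.YBasis s t).repr U I := by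
  have h : pairing (X s t I) = (NCSF.YBasis s t).coord I := by
    refine (NCSF.SBasis K).ext fun J => ?_
    rw [pairing, Basis.constr_basis]
    change (NCSF.YBasis s t).repr (NCSF.SBasis K (exponentWord (packedMonomial J))) I = _
    rw [exponentWord_packedMonomial]
    rfl
  rw [h]
  rfl

/-- `⟨X_I, Y^J⟩ = δ_{I,J}`. -/
theorem pairing_X_Y (s t : K) (I J : FreeMonoid ℕ+) [Decidable (I = J)] :
    pairing (X s t I) (NCSF.wordProd (NCSF.Y s t) J) = if I = J then 1 else 0 := by
  classical
  rw [pairing_X, ← NCSF.YBasis_apply, Basis.repr_self, Finsupp.single_apply]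
  split_ifs <;> simp_all

theorem X_mem_quasiSymm (s t : K) (I : FreeMonoid ℕ+) : X s t I ∈ quasiSymm K := by
  refine ⟨⟨(I.toList.map PNat.val).sum, fun m hm => ?_⟩, fun m m' h => ?_⟩
  · refine NCSF.YBasis_repr_eq_zero s t I _ ?_
    rw [sum_exponentWord]
    exact hm.ne
  · change (NCSF.YBasis s t).repr _ I = (NCSF.YBasis s t).repr _ I
    rw [h]

theorem coeff_eq_pairing {R : Type*} [CommRing R] {F : MvPowerSeries ℕ R} (hF : F ∈ quasiSymm R) (m : ℕ →₀ ℕ) :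
    MvPowerSeries.coeff m F = pairing F (NCSF.SBasis R (exponentWord m)) := by
  rw [pairing, Basis.constr_basis]
  exact hF.2 _ _ (exponentWord_packedMonomial _).symm

/-- `X_I` is the only quasi-symmetric function with `⟨X_I, Y^J⟩ = δ_{I,J}` for all `J`. -/
theorem eq_X (s t : K) (I : FreeMonoid ℕ+) {F : MvPowerSeries ℕ K} (hF : F ∈ quasiSymm K)
    (h : ∀ J, pairing F (NCSF.wordProd (NCSF.Y s t) J) =
      pairing (X s t I) (NCSF.wordProd (NCSF.Y s t) J)) : F = X s t I := by
  have h' : pairing F = pairing (X s t I) :=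
    (NCSF.YBasis s t).ext fun J => by rw [NCSF.YBasis_apply, h J]
  ext m
  rw [coeff_eq_pairing hF, coeff_eq_pairing (X_mem_quasiSymm s t I), h']

end QSym

end

/-! The product of $QSym$ is dual to the coproduct of $\mathbf{Sym}$ for which $\sigma_z$ is
group-like. The coefficients of $X_{1^p}$ on the $M_J$ are the $w^p$-coefficients, at $S^J$, of the
character $Y_1\mapsto w$, $Y_n\mapsto 0$ for $n\ge2$ (`YBasis_repr_replicate`). Hence
$\sum_{p,q}u^pv^qX_{1^p}X_{1^q}$ is represented by the convolution of the characters with parameters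
$u$ and $v$ (`coeff_X_replicate_mul`), which maps $\sigma_z$ to a product $A(z)B(z)$ over a
commutative ring, with $f(\log A)=uz$ and $f(\log B)=vz$.

Since $f'=1+\alpha f+\beta f^2$ and $f(0)=0$, the series $f$ has the addition law $(x+y+\alpha
xy)/(1-\beta xy)$. The convolution therefore sends $Y_n$ to the coefficient of $z^n$ in
$((u+v)z+\alpha uvz^2)/(1-\beta uvz^2)$ (`comp_log_mul`, `convChar_Y`): this is $(u+v)(uv)^k\beta^k$
for $n=2k+1$ and $\alpha(uv)^{k+1}\beta^k$ for $n=2k+2$. Multiplying over the parts of $I$ and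
extracting $u^pv^q$ gives the coefficient of $X_I$; the binomial comes from $(u+v)^{\ell_1(I)}$. -/

noncomputable section

namespace NCSF

/-! ### The rational group law and the Riccati equation of $f$ -/

open PowerSeries

/-- The coefficients of the formal group law `(x + y + a x y) / (1 - b x y)` at
`x = u z`, `y = v z`. -/
def hyperbolicCoeff {R : Type*} [CommRing R] (a b u v : R) : ℕ → R
  | 0 => 0
  | 1 => u + v
  | 2 => a * (u * v)
  | n + 3 => b * (u * v) * hyperbolicCoeff a b u v (n + 1)

theorem mk_hyperbolicCoeff_mul {R : Type*} [CommRing R] (a b u v : R) :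
    PowerSeries.mk (hyperbolicCoeff a b u v) * (1 - C (b * (u * v)) * X ^ 2) =
      C (u + v) * X + C (a * (u * v)) * X ^ 2 := by
  ext n
  rw [mul_sub, mul_one, mul_left_comm]
  simp only [map_sub, map_add, coeff_C_mul, coeff_mk, coeff_mul_X_pow']
  rcases n with _ | _ | _ | n <;> simp [hyperbolicCoeff]

section HyperbolicLaw

variable {K : Type*} [CommRing K]

/-- Composition with a series without constant term, over a commutative algebra, is substitution. -/
theorem comp_eq_subst {R : Type*} [CommRing R] [Algebra K R] (c : PowerSeries K)
    {g : PowerSeries R} (hg : constantCoeff g = 0) :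
    comp c g = (PowerSeries.map (algebraMap K R) c).subst g := by
  ext n
  rw [coeff_subst' (HasSubst.of_constantCoeff_zero' hg), comp, coeff_mk,
    finsum_eq_sum_of_support_subset (s := Finset.range (n + 1))]
  · simp [Algebra.smul_def]
  · intro k hk
    by_contra h
    refine hk ?_
    have : coeff n (g ^ k) = 0 := by
      refine coeff_of_lt_order _ (lt_of_lt_of_le ?_ (le_order_pow_of_constantCoeff_eq_zero k hg))
      simpa using h
    simp [this]

theorem constantCoeff_comp {R : Type*} [CommRing R] [Algebra K R] {c : PowerSeries K}
    (hc : constantCoeff c = 0)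
    (g : PowerSeries R) :
    constantCoeff (comp c g) = 0 := by
  rw [← coeff_zero_eq_constantCoeff_apply, comp, coeff_mk]
  simp [hc]

/-- Naturality moves $f(\log\sigma_z)$ from the free algebra to a commutative ring, where
substitution and the chain rule apply. -/
theorem map_comp {A B : Type*} [Ring A] [Algebra K A] [Ring B] [Algebra K B] (ρ : A →ₐ[K] B)
    (c : PowerSeries K) (g : PowerSeries A) :
    PowerSeries.map (ρ : A →+* B) (comp c g) = comp c (PowerSeries.map (ρ : A →+* B) g) := by
  ext n
  simp only [comp, coeff_map, coeff_mk, map_sum, ← map_pow]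
  exact Finset.sum_congr rfl fun k _ => map_smul ρ _ _

variable [Algebra ℚ K]

theorem inv_factorial_succ_mul (n : ℕ) :
    algebraMap ℚ K (1 / ((n + 1).factorial : ℚ)) * ((n : K) + 1) =
      algebraMap ℚ K (1 / (n.factorial : ℚ)) := by
  have h1 : ((n : K) + 1) = algebraMap ℚ K (n + 1) := by simp
  rw [h1, ← map_mul]
  congr 1
  have : ((n : ℚ) + 1) ≠ 0 := by positivity
  have : (n.factorial : ℚ) ≠ 0 := by positivity
  rw [Nat.factorial_succ]
  push_cast
  field_simp

theorem derivative_rescale_exp (s : K) :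
    d⁄dX K (rescale s (exp K)) = C s * rescale s (exp K) := by
  ext n
  rw [coeff_derivative, coeff_rescale, coeff_C_mul, coeff_rescale, coeff_exp, coeff_exp, mul_assoc,
    inv_factorial_succ_mul]
  ring

/-- Argued on coefficients, since $s-t$ need not be invertible or even nonzero. -/
theorem derivative_expDiff (s t : K) :
    d⁄dX K (expDiff s t) = rescale s (exp K) + C t * expDiff s t := by
  ext n
  have h2 : ∑ i ∈ Finset.range (n + 1), s ^ i * t ^ (n - i) =
      s ^ n + t * ∑ i ∈ Finset.range n, s ^ i * t ^ (n - 1 - i) := by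
    rw [Finset.sum_range_succ, Finset.mul_sum, add_comm]
    congr 1
    · simp
    · refine Finset.sum_congr rfl fun i hi => ?_
      have := Finset.mem_range.1 hi
      rw [show n - i = n - 1 - i + 1 by omega]
      ring
  rw [coeff_derivative, map_add, coeff_rescale, coeff_C_mul, coeff_exp, expDiff, coeff_mk, coeff_mk,
    Nat.add_sub_cancel, h2, mul_right_comm, inv_factorial_succ_mul]
  ring

theorem constantCoeff_expDiff (s t : K) : constantCoeff (expDiff s t) = 0 := by
  rw [← coeff_zero_eq_constantCoeff_apply, expDiff, coeff_mk]
  simp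

theorem constantCoeff_fSeries (s t : K) : constantCoeff (fSeries s t) = 0 := by
  rw [fSeries, map_mul, constantCoeff_expDiff, zero_mul]

/-- The Riccati equation `f' = 1 + (s + t) f + s t f ^ 2`. -/
theorem derivative_fSeries (s t : K) :
    d⁄dX K (fSeries s t) =
      1 + C (s + t) * fSeries s t + C (s * t) * fSeries s t ^ 2 := by
  have hf := fSeries_mul_aux s t
  have hd := congrArg (d⁄dX K) hf
  simp only [Derivation.leibniz, map_sub, derivative_rescale_exp, derivative_expDiff,
    derivative_C, smul_eq_mul, mul_zero, add_zero] at hd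
  set E := expDiff s t
  set e := rescale s (exp K)
  set f := fSeries s t
  have hu : IsUnit (e - C s * E) := by
    rw [isUnit_iff_constantCoeff, map_sub, map_mul, constantCoeff_expDiff,
      ← coeff_zero_eq_constantCoeff_apply, coeff_rescale]
    simp
  -- With $D=e-sE$ one has $fD=E$ and $D'=-stE$. The term $f^2$ requires clearing $D$ twice.
  refine hu.mul_left_cancel (hu.mul_left_cancel ?_)
  rw [map_add, map_mul]
  linear_combination (e - C s * E) * hd +
    (C s * C t * E - (C s + C t) * (e - C s * E) - C s * C t * (f * (e - C s * E) + E)) * hf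

end HyperbolicLaw

/-! ### Uniqueness for Riccati equations and the addition formula -/

section Uniqueness

variable {R : Type*} [CommRing R] [Algebra ℚ R]

/-- A linear homogeneous differential equation has only the zero solution without constant term. -/
theorem eq_zero_of_derivative_eq_mul {δ h : PowerSeries R} (h0 : constantCoeff δ = 0)
    (hδ : d⁄dX R δ = δ * h) : δ = 0 := by
  ext n
  rw [map_zero]
  induction n using Nat.strong_induction_on with
  | _ n ih =>
    rcases n with _ | n
    · simpa using h0
    · have h1 := congrArg (coeff n) hδ
      rw [coeff_derivative, coeff_mul, Finset.sum_eq_zero] at h1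
      · have h2 : IsUnit ((n : R) + 1) := by
          have h3 : ((n : R) + 1) = algebraMap ℚ R (n + 1) := by simp
          rw [h3]
          exact (IsUnit.mk0 _ (by positivity)).map _
        exact h2.mul_left_eq_zero.1 h1
      · intro p hp
        rw [ih p.1 (by have := Finset.HasAntidiagonal.mem_antidiagonal.1 hp; omega), zero_mul]

/-- Uniqueness for a Riccati equation, with a logarithmic derivative on the right-hand side. -/
theorem eq_of_riccati {P V W : PowerSeries R} {a b : R} (hP : IsUnit P)
    (hV : P * d⁄dX R V = d⁄dX R P * (1 + C a * V + C b * V ^ 2))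
    (hW : P * d⁄dX R W = d⁄dX R P * (1 + C a * W + C b * W ^ 2))
    (h0 : constantCoeff V = constantCoeff W) : V = W := by
  obtain ⟨Q, hQ⟩ := hP.exists_left_inv
  -- The difference of two solutions solves a linear equation:
  -- $(V-W)'=(V-W)\,\frac{P'}{P}\,(a+b(V+W))$.
  refine sub_eq_zero.1 (eq_zero_of_derivative_eq_mul
    (h := Q * d⁄dX R P * (C a + C b * (V + W))) (by rw [map_sub, h0, sub_self]) ?_)
  rw [map_sub]
  linear_combination Q * hV - Q * hW - (d⁄dX R V - d⁄dX R W) * hQ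

variable {K : Type*} [CommRing K] [Algebra ℚ K] [Algebra K R]

theorem derivative_comp_log {A : PowerSeries R} (hA : constantCoeff A = 1) :
    A * d⁄dX R (comp (log K) (A - 1)) = d⁄dX R A := by
  have h0 : constantCoeff (A - 1) = 0 := by simp [hA]
  have hs := HasSubst.of_constantCoeff_zero' h0
  have hl : (1 + X) * d⁄dX R (log R) = 1 := by
    rw [deriv_log]
    ext n
    rcases n with _ | n
    · simp
    · rw [add_mul, one_mul, map_add, coeff_succ_X_mul, coeff_mk, coeff_mk, coeff_one, ← map_add]
      simp [pow_succ]
  have h1 := congrArg (fun c => PowerSeries.subst (A - 1) c) hl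
  simp only [subst_mul hs, subst_add hs, subst_X hs] at h1
  rw [← coe_substAlgHom hs, map_one, coe_substAlgHom] at h1
  rw [comp_eq_subst _ h0, map_log, derivative_subst hs, map_sub, derivative_one, sub_zero]
  linear_combination d⁄dX R A * h1

/-- Chain rule for $f\circ\log A$ with $A(\log A)'=A'$. In this form the factor $A'/A$ is additive
when series are multiplied, which is what the addition formula needs. -/
theorem riccati_comp (s t : K) {A : PowerSeries R} (hA : constantCoeff A = 1) :
    A * d⁄dX R (comp (fSeries s t) (comp (log K) (A - 1))) =
      d⁄dX R A * (1 + C (algebraMap K R (s + t)) * comp (fSeries s t) (comp (log K) (A - 1)) +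
        C (algebraMap K R (s * t)) * comp (fSeries s t) (comp (log K) (A - 1)) ^ 2) := by
  have hl := derivative_comp_log (K := K) hA
  have h0 : constantCoeff (comp (log K) (A - 1)) = 0 := constantCoeff_comp constantCoeff_log _
  set L := comp (log K) (A - 1)
  have hs := HasSubst.of_constantCoeff_zero' h0
  have hd : d⁄dX R (PowerSeries.map (algebraMap K R) (fSeries s t)) =
      PowerSeries.map (algebraMap K R) (d⁄dX K (fSeries s t)) := by
    ext n
    simp [coeff_derivative]
  rw [comp_eq_subst _ h0, derivative_subst hs, hd, derivative_fSeries]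
  simp only [map_add, map_mul, map_one, map_pow, PowerSeries.map_C]
  simp only [← coe_substAlgHom hs, map_add, map_mul, map_one, map_pow]
  simp only [coe_substAlgHom hs, subst_C]
  rw [← hl]
  ring!

/-- The addition formula for `f`, after substitution of logarithms. -/
theorem comp_log_mul (s t : K) {A B : PowerSeries R} (hA : constantCoeff A = 1)
    (hB : constantCoeff B = 1) {u v : R}
    (hAu : comp (fSeries s t) (comp (log K) (A - 1)) = C u * X)
    (hBv : comp (fSeries s t) (comp (log K) (B - 1)) = C v * X) :
    comp (fSeries s t) (comp (log K) (A * B - 1)) =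
      PowerSeries.mk (hyperbolicCoeff (algebraMap K R (s + t)) (algebraMap K R (s * t)) u v) := by
  have hAB : constantCoeff (A * B) = 1 := by rw [map_mul, hA, hB, one_mul]
  have h1 := riccati_comp s t hA
  have h2 := riccati_comp s t hB
  have h3 := riccati_comp s t hAB
  set a := algebraMap K R (s + t)
  set b := algebraMap K R (s * t)
  have hV := mk_hyperbolicCoeff_mul a b u v
  have hV0 : constantCoeff (PowerSeries.mk (hyperbolicCoeff a b u v)) = 0 := by
    rw [← coeff_zero_eq_constantCoeff_apply, coeff_mk, hyperbolicCoeff]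
  set V := PowerSeries.mk (hyperbolicCoeff a b u v)
  -- Both sides vanish at $0$, so it suffices that the closed form solves the Riccati equation
  -- attached to $AB$.
  refine eq_of_riccati (by rw [isUnit_iff_constantCoeff, hAB]; exact isUnit_one) h3 ?_
    (by rw [hV0]; exact constantCoeff_comp (constantCoeff_fSeries s t) _)
  have hd := congrArg (d⁄dX R) hV
  rw [hAu] at h1
  rw [hBv] at h2
  simp only [Derivation.leibniz, Derivation.leibniz_pow, map_sub, map_add, derivative_C,
    derivative_X, derivative_one, smul_eq_mul, nsmul_eq_mul, mul_zero, add_zero, zero_sub, mul_one,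
    map_mul] at h1 h2 hd hV ⊢
  norm_num at hd
  have hu : IsUnit (1 - C b * (C u * C v) * X ^ 2) := by
    rw [isUnit_iff_constantCoeff]
    simp
  -- Differentiating the quotient squares its denominator, hence two cancellations; what remains is
  -- a polynomial identity modulo the equations for $A$, $B$ and $V$.
  refine hu.mul_left_cancel (hu.mul_left_cancel ?_)
  generalize d⁄dX R A = A' at *
  generalize d⁄dX R B = B' at *
  generalize d⁄dX R V = V' at *
  generalize (C a : PowerSeries R) = a at *
  generalize (C b : PowerSeries R) = b at *
  generalize (C u : PowerSeries R) = u at *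
  generalize (C v : PowerSeries R) = v at *
  generalize (X : PowerSeries R) = z at *
  linear_combination A * B * ((1 - b * (u * v) * z ^ 2) * hd + 2 * b * u * v * z * hV) -
    (A * B' + B * A') * (a * (1 - b * (u * v) * z ^ 2) +
      b * (V * (1 - b * (u * v) * z ^ 2) + (u + v) * z + a * (u * v) * z ^ 2)) * hV +
    B * (1 + a * (v * z) + b * (v * z) ^ 2) * h1 + A * (1 + a * (u * z) + b * (u * z) ^ 2) * h2

end Uniqueness

end NCSF

/-! ### Monomials and products of convolutions -/

namespace NCSF

theorem constantCoeff_map_sigma {K : Type*} [CommRing K] {R : Type*} [CommRing R] [Algebra K R]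
    (ρ : FreeAlgebra K ℕ+ →ₐ[K] R) :
    PowerSeries.constantCoeff (PowerSeries.map (ρ : FreeAlgebra K ℕ+ →+* R) (sigma K)) = 1 := by
  rw [← PowerSeries.coeff_zero_eq_constantCoeff_apply, PowerSeries.coeff_map, sigma,
    PowerSeries.coeff_mk, complete]
  simp

/-- A product of convolutions, expanded over the decompositions of a multi-exponent. -/
theorem prod_sum_antidiagonal {R : Type*} [CommSemiring R] (F G : ℕ → R) (hF : F 0 = 1)
    (hG : G 0 = 1) (m : ℕ →₀ ℕ) :
    (m.prod fun _ n => ∑ x ∈ Finset.HasAntidiagonal.antidiagonal n, F x.1 * G x.2) =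
      ∑ x ∈ Finset.HasAntidiagonal.antidiagonal m, (x.1.prod fun _ => F) * x.2.prod fun _ => G := by
  classical
  rw [Finsupp.prod, Finset.prod_sum]
  refine Finset.sum_bij'
    (fun a _ => (Finsupp.indicator m.support fun k hk => (a k hk).1,
      Finsupp.indicator m.support fun k hk => (a k hk).2))
    (fun x _ k _ => (x.1 k, x.2 k)) ?_ ?_ ?_ ?_ ?_
  · intro a ha
    rw [Finset.mem_pi] at ha
    rw [Finset.HasAntidiagonal.mem_antidiagonal]
    ext k
    by_cases hk : k ∈ m.support
    · have := Finset.HasAntidiagonal.mem_antidiagonal.1 (ha k hk)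
      simp only [Finsupp.add_apply, Finsupp.indicator_apply, dif_pos hk, this]
    · simp only [Finsupp.add_apply, Finsupp.indicator_apply, dif_neg hk]
      simpa using (Finsupp.notMem_support_iff.1 hk).symm
  · intro x hx
    rw [Finset.HasAntidiagonal.mem_antidiagonal] at hx
    rw [Finset.mem_pi]
    intro k _
    rw [Finset.HasAntidiagonal.mem_antidiagonal, ← hx]
    rfl
  · intro a ha
    funext k hk
    simp only [Finsupp.indicator_apply, dif_pos hk]
  · intro x hx
    rw [Finset.HasAntidiagonal.mem_antidiagonal] at hx
    have h0 : ∀ k, k ∉ m.support → x.1 k = 0 ∧ x.2 k = 0 := by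
      intro k hk
      rw [Finsupp.notMem_support_iff, ← hx, Finsupp.add_apply] at hk
      omega
    refine Prod.ext (Finsupp.ext fun k => ?_) (Finsupp.ext fun k => ?_)
    · by_cases hk : k ∈ m.support
      · simp only [Finsupp.indicator_apply, dif_pos hk]
      · simp only [Finsupp.indicator_apply, dif_neg hk, (h0 k hk).1]
    · by_cases hk : k ∈ m.support
      · simp only [Finsupp.indicator_apply, dif_pos hk]
      · simp only [Finsupp.indicator_apply, dif_neg hk, (h0 k hk).2]
  · intro a ha
    rw [Finset.prod_mul_distrib]
    congr 1
    -- The support of a summand may be smaller than that of `m`; the extra factors are $F(0)=1$.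
    · rw [Finsupp.prod_of_support_subset _ (Finsupp.support_indicator_subset _ _) _ fun _ _ => hF,
        ← Finset.prod_attach m.support]
      exact Finset.prod_congr rfl fun k _ => by
        rw [Finsupp.indicator_apply, dif_pos k.2]
    · rw [Finsupp.prod_of_support_subset _ (Finsupp.support_indicator_subset _ _) _ fun _ _ => hG,
        ← Finset.prod_attach m.support]
      exact Finset.prod_congr rfl fun k _ => by
        rw [Finsupp.indicator_apply, dif_pos k.2]

/-- In a commutative target the order of the letters is immaterial, so a word becomes a product over
the variables of the monomial. -/
theorem map_SBasis_exponentWord {K : Type*} [CommRing K] {R : Type*} [CommRing R] [Algebra K R]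
    (ρ : FreeAlgebra K ℕ+ →ₐ[K] R) (m : ℕ →₀ ℕ) :
    ρ (SBasis K (QSym.exponentWord m)) = m.prod fun _ n => ρ (complete K n) := by
  have h : ∀ k ∈ m.support.sort (· ≤ ·),
      ρ (FreeAlgebra.ι K (m k).toPNat') = ρ (complete K (m k)) := by
    intro k hk
    rw [Finset.mem_sort, Finsupp.mem_support_iff] at hk
    rw [complete, dif_pos (Nat.pos_of_ne_zero hk)]
    congr 2
    exact PNat.coe_injective (PNat.toPNat'_coe (Nat.pos_of_ne_zero hk))
  rw [SBasis_apply, wordProd, QSym.exponentWord, FreeMonoid.toList_ofList, map_list_prod,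
    List.map_map, List.map_map, Finsupp.prod]
  have h2 := List.prod_toFinset (fun k => ρ (complete K (m k)))
    (Finset.sort_nodup m.support (· ≤ ·))
  rw [Finset.sort_toFinset] at h2
  rw [h2]
  exact congrArg List.prod (List.map_congr_left h)

/-! ### Characters of $\mathbf{Sym}$ and their convolution -/

section Characters

variable {K : Type*} [CommRing K] [Algebra ℚ K] (s t : K)
  {R : Type*} [CommRing R] [Algebra K R]

/-- The algebra morphism with prescribed values on the generators `Y_n`. -/
def liftY (r : ℕ+ → R) : FreeAlgebra K ℕ+ →ₐ[K] R :=
  (FreeAlgebra.lift K r).comp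
    (AlgEquiv.ofBijective (FreeAlgebra.lift K (Y s t)) (lift_bijective (Y_sub_mem s t))).symm

theorem liftY_Y (r : ℕ+ → R) (n : ℕ+) : liftY s t r (Y s t n) = r n := by
  have h : (AlgEquiv.ofBijective (FreeAlgebra.lift K (Y s t))
      (lift_bijective (Y_sub_mem s t))).symm (Y s t n) = FreeAlgebra.ι K n := by
    rw [AlgEquiv.symm_apply_eq]
    simp
  rw [liftY, AlgHom.comp_apply]
  exact (congrArg _ h).trans (FreeAlgebra.lift_ι_apply _ _)

theorem comp_liftY {R' : Type*} [CommRing R'] [Algebra K R'] (g : R →ₐ[K] R') (r : ℕ+ → R) :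
    g.comp (liftY s t r) = liftY s t (fun n => g (r n)) := by
  rw [liftY, liftY, ← AlgHom.comp_assoc]
  congr 1
  refine FreeAlgebra.hom_ext (funext fun n => ?_)
  simp

/-- The algebra morphism with `Y_1 ↦ w` and `Y_n ↦ 0` for `n ≥ 2`. -/
def onesChar (w : R) : FreeAlgebra K ℕ+ →ₐ[K] R :=
  liftY s t fun n => if n = 1 then w else 0

theorem apply_onesChar {R' : Type*} [CommRing R'] [Algebra K R'] (g : R →ₐ[K] R') (w : R)
    (U : FreeAlgebra K ℕ+) : g (onesChar s t w U) = onesChar s t (g w) U := by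
  rw [onesChar, ← AlgHom.comp_apply, comp_liftY, onesChar]
  congr 2
  ext n
  split_ifs <;> simp

/-- In degree $n\ge1$ the left side is $\rho(Y_n)$, so the values on the $Y_n$ are governed by the
image of $\sigma_z$ alone. -/
theorem map_phi (ρ : FreeAlgebra K ℕ+ →ₐ[K] R) :
    PowerSeries.map (ρ : FreeAlgebra K ℕ+ →+* R) (comp (fSeries s t) (phi K)) =
      comp (fSeries s t) (comp (PowerSeries.log K)
        (PowerSeries.map (ρ : FreeAlgebra K ℕ+ →+* R) (sigma K) - 1)) := by
  rw [map_comp, phi, map_comp, map_sub, map_one]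

/-- Only $Y_1$ survives, so $Y$ goes to $wz$. This implicit description of the image of $\sigma_z$
is enough; no explicit formula is needed. -/
theorem onesChar_sigma (w : R) :
    comp (fSeries s t) (comp (PowerSeries.log K)
        (PowerSeries.map (onesChar s t w : FreeAlgebra K ℕ+ →+* R) (sigma K) - 1)) =
      PowerSeries.C w * PowerSeries.X := by
  rw [← map_phi]
  ext n
  rw [PowerSeries.coeff_map, PowerSeries.coeff_C_mul, PowerSeries.coeff_X]
  rcases Nat.eq_zero_or_pos n with rfl | hn
  · have := constantCoeff_fSeries s t
    rw [← PowerSeries.coeff_zero_eq_constantCoeff_apply] at this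
    simp [comp, this]
  · lift n to ℕ+ using hn
    change onesChar s t w (Y s t n) = _
    rw [onesChar, liftY_Y]
    simp

/-- The convolution of `onesChar u` and `onesChar v` for the coproduct in which the series `σ_z` is
group-like. -/
def convChar (u v : R) : FreeAlgebra K ℕ+ →ₐ[K] R :=
  FreeAlgebra.lift K fun n => PowerSeries.coeff n
    (PowerSeries.map (onesChar s t u : FreeAlgebra K ℕ+ →+* R) (sigma K) *
      PowerSeries.map (onesChar s t v : FreeAlgebra K ℕ+ →+* R) (sigma K))

theorem map_convChar_sigma (u v : R) :
    PowerSeries.map (convChar s t u v : FreeAlgebra K ℕ+ →+* R) (sigma K) =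
      PowerSeries.map (onesChar s t u : FreeAlgebra K ℕ+ →+* R) (sigma K) *
        PowerSeries.map (onesChar s t v : FreeAlgebra K ℕ+ →+* R) (sigma K) := by
  ext n
  rcases Nat.eq_zero_or_pos n with rfl | hn
  · rw [PowerSeries.coeff_zero_eq_constantCoeff_apply,
      PowerSeries.coeff_zero_eq_constantCoeff_apply, map_mul]
    simp only [constantCoeff_map_sigma, one_mul]
  · rw [PowerSeries.coeff_map, sigma, PowerSeries.coeff_mk, complete, dif_pos hn,
      AlgHom.coe_toRingHom,
      convChar, FreeAlgebra.lift_ι_apply]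
    rfl

theorem convChar_complete (u v : R) (n : ℕ) :
    convChar s t u v (complete K n) = ∑ x ∈ Finset.HasAntidiagonal.antidiagonal n,
      onesChar s t u (complete K x.1) * onesChar s t v (complete K x.2) := by
  have h := congrArg (PowerSeries.coeff n) (map_convChar_sigma s t u v)
  simpa [PowerSeries.coeff_mul, sigma] using h

theorem convChar_Y [Algebra ℚ R] (u v : R) (n : ℕ+) :
    convChar s t u v (Y s t n) =
      hyperbolicCoeff (algebraMap K R (s + t)) (algebraMap K R (s * t)) u v n := by
  have h := comp_log_mul s t (constantCoeff_map_sigma _) (constantCoeff_map_sigma _)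
    (onesChar_sigma s t u) (onesChar_sigma s t v)
  rw [← map_convChar_sigma, ← map_phi] at h
  have h' := congrArg (PowerSeries.coeff (n : ℕ)) h
  rwa [PowerSeries.coeff_mk, PowerSeries.coeff_map] at h'

open Polynomial in
/-- The coefficient on `Y_1 ^ p` in the basis `Y^I`. -/
theorem YBasis_repr_replicate (p : ℕ) (U : FreeAlgebra K ℕ+) :
    (YBasis s t).repr U (FreeMonoid.ofList (List.replicate p 1)) =
      (onesChar s t (X : K[X]) U).coeff p := by
  classical
  have h : (YBasis s t).coord (FreeMonoid.ofList (List.replicate p 1)) =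
      lcoeff K p ∘ₗ (onesChar s t (X : K[X])).toLinearMap := by
    refine (YBasis s t).ext fun J => ?_
    rw [Basis.coord_apply, Basis.repr_self, Finsupp.single_apply, LinearMap.comp_apply, lcoeff_apply,
      AlgHom.toLinearMap_apply, YBasis_apply, wordProd, map_list_prod, List.map_map]
    -- The image of $Y^L$ is $X^{|L|}$ if every letter is $1$ and $0$ otherwise. The exponent varies
    -- in the induction because removing a letter lowers the degree.
    have hL : ∀ (L : List ℕ+) (p : ℕ),
        ((L.map (⇑(onesChar s t (X : K[X])) ∘ Y s t)).prod).coeff p =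
          if L = List.replicate p 1 then 1 else 0 := by
      intro L
      induction L with
      | nil => intro p; cases p <;> simp [coeff_one]
      | cons n L ih =>
        intro p
        rw [List.map_cons, List.prod_cons, Function.comp_apply, onesChar, liftY_Y, ← onesChar]
        by_cases hn : n = 1
        · cases p <;> simp [hn, ih, List.replicate_succ]
        · cases p <;> simp [hn, List.replicate_succ]
    refine Eq.trans ?_ (hL J.toList p).symm
    exact if_congr Iff.rfl rfl rfl
  exact LinearMap.congr_fun h U

/-- The sum runs over factorizations of the monomial, exactly as in the coefficient of a product of
power series: this is the duality between product and coproduct. -/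
theorem convChar_SBasis_exponentWord (u v : R) (m : ℕ →₀ ℕ) :
    convChar s t u v (SBasis K (QSym.exponentWord m)) = ∑ x ∈ Finset.HasAntidiagonal.antidiagonal m,
      onesChar s t u (SBasis K (QSym.exponentWord x.1)) *
        onesChar s t v (SBasis K (QSym.exponentWord x.2)) := by
  simp only [map_SBasis_exponentWord, convChar_complete]
  exact prod_sum_antidiagonal (fun n => onesChar s t u (complete K n))
    (fun n => onesChar s t v (complete K n)) (by simp [complete]) (by simp [complete]) m

open Polynomial in
/-- The coefficients of a product `X_{1^p} X_{1^q}`, through the polynomial ring `K[v][u]`. -/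
theorem coeff_X_replicate_mul (p q : ℕ) (m : ℕ →₀ ℕ) :
    MvPowerSeries.coeff m
      (QSym.X s t (FreeMonoid.ofList (List.replicate p 1)) *
        QSym.X s t (FreeMonoid.ofList (List.replicate q 1))) =
      ((convChar s t (X : K[X][X]) (C X) (SBasis K (QSym.exponentWord m))).coeff p).coeff q := by
  rw [convChar_SBasis_exponentWord, finsetSum_coeff, finsetSum_coeff, MvPowerSeries.coeff_mul]
  refine Finset.sum_congr rfl fun x _ => ?_
  change (YBasis s t).repr (SBasis K (QSym.exponentWord x.1)) _ *
    (YBasis s t).repr (SBasis K (QSym.exponentWord x.2)) _ = _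
  -- The one-variable characters are transported to $K[v][u]$: the outer variable is $u$, and $v$
  -- enters as a constant.
  have hu := apply_onesChar s t (mapAlgHom (CAlgHom : K →ₐ[K] K[X])) X
    (SBasis K (QSym.exponentWord x.1))
  have hv := apply_onesChar s t (CAlgHom : K[X] →ₐ[K] K[X][X]) X
    (SBasis K (QSym.exponentWord x.2))
  simp only [coe_mapAlgHom, CAlgHom_apply, map_X] at hu hv
  rw [← hu, ← hv, YBasis_repr_replicate, YBasis_repr_replicate, coeff_mul_C, coeff_map]
  simp

end Characters

/-! ### Explicit values of the convolution on the $Y^J$ -/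

theorem hyperbolicCoeff_two_mul_add_one {R : Type*} [CommRing R] (a b u v : R) (n : ℕ) :
    hyperbolicCoeff a b u v (2 * n + 1) = (u + v) * (u * v) ^ n * b ^ n := by
  induction n with
  | zero => simp [hyperbolicCoeff]
  | succ n ih =>
    rw [show 2 * (n + 1) + 1 = 2 * n + 3 by ring, hyperbolicCoeff, ih]
    ring

theorem hyperbolicCoeff_two_mul_add_two {R : Type*} [CommRing R] (a b u v : R) (n : ℕ) :
    hyperbolicCoeff a b u v (2 * n + 2) = a * (u * v) ^ (n + 1) * b ^ n := by
  induction n with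
  | zero => simp [hyperbolicCoeff]
  | succ n ih =>
    rw [show 2 * (n + 1) + 2 = 2 * n + 1 + 3 by ring, hyperbolicCoeff, ih]
    ring

/-- A part $2k+1$ contributes $k$ to the exponents of both $uv$ and $b$; a part $2k+2$ contributes
$k+1$ and $k$. Taking the exponent `e` of $b$ as a witness avoids truncated subtraction. -/
theorem prod_hyperbolicCoeff {R : Type*} [CommRing R] (a b u v : R) (L : List ℕ)
    (hL : ∀ n ∈ L, 0 < n) :
    ∃ e : ℕ, L.countP (fun i => Odd i) + 2 * (e + L.countP (fun i => Even i)) = L.sum ∧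
      (L.map (hyperbolicCoeff a b u v)).prod =
        (u + v) ^ L.countP (fun i => Odd i) * (u * v) ^ (e + L.countP (fun i => Even i)) *
          (a ^ L.countP (fun i => Even i) * b ^ e) := by
  induction L with
  | nil => exact ⟨0, by simp⟩
  | cons n L ih =>
    obtain ⟨e, he, hp⟩ := ih fun m hm => hL m (List.mem_cons_of_mem _ hm)
    have hn := hL n List.mem_cons_self
    rw [List.map_cons, List.prod_cons, hp, List.sum_cons]
    rcases Nat.even_or_odd' n with ⟨k, rfl | rfl⟩
    · obtain ⟨k, rfl⟩ := Nat.exists_eq_succ_of_ne_zero (show k ≠ 0 by omega)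
      have h1 : ¬ Odd (2 * (k + 1)) := by simp
      have h2 : Even (2 * (k + 1)) := by simp
      rw [List.countP_cons_of_neg (by simp), List.countP_cons_of_pos (by simp),
        Nat.succ_eq_add_one, mul_add, mul_one, hyperbolicCoeff_two_mul_add_two]
      exact ⟨e + k, by omega, by ring⟩
    · have h1 : Odd (2 * k + 1) := by simp
      have h2 : ¬ Even (2 * k + 1) := by simp
      rw [List.countP_cons_of_pos (by simp), List.countP_cons_of_neg (by simp),
        hyperbolicCoeff_two_mul_add_one]
      exact ⟨e + k, by omega, by ring⟩

open Polynomial in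
theorem coeff_add_pow_mul_pow {K : Type*} [CommRing K] (l m p q : ℕ) :
    (((X + C X : K[X][X]) ^ l * (X * C X) ^ m).coeff p).coeff q =
      if p + q = l + 2 * m then (QSym.binom l ((p : ℤ) - m) : K) else 0 := by
  rw [mul_pow, ← C_pow, mul_comm (X ^ m), ← mul_assoc, coeff_mul_X_pow']
  by_cases hm : m ≤ p
  · obtain ⟨r, rfl⟩ := Nat.exists_eq_add_of_le hm
    have hb : QSym.binom l (((m + r : ℕ) : ℤ) - m) = l.choose r := by
      rw [QSym.binom, if_pos (by push_cast; omega)]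
      congr 1
      push_cast
      omega
    rw [if_pos hm, Nat.add_sub_cancel_left, coeff_mul_C, coeff_X_add_C_pow, hb,
      mul_right_comm, ← pow_add,
      coeff_mul_natCast, coeff_X_pow]
    -- The exponent $l-r$ is a truncated subtraction; for $r>l$ the vanishing binomial makes it
    -- harmless.
    by_cases hr : r ≤ l
    · by_cases h : m + r + q = l + 2 * m
      · rw [if_pos h, if_pos (by omega), one_mul]
      · rw [if_neg h, if_neg (by omega), zero_mul]
    · rw [Nat.choose_eq_zero_of_lt (by omega)]
      simp
  · have hb : QSym.binom l ((p : ℤ) - m) = 0 := by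
      rw [QSym.binom, if_neg (by omega)]
    rw [if_neg hm, hb]
    simp

open Polynomial in
theorem coeff_convChar_YBasis {K : Type*} [CommRing K] [Algebra ℚ K] (s t : K) (p q : ℕ)
    (J : FreeMonoid ℕ+) :
    ((convChar s t (X : K[X][X]) (C X) (YBasis s t J)).coeff p).coeff q =
      if (J.toList.map PNat.val).sum = p + q then
        (QSym.binom ((J.toList.map PNat.val).countP (fun i => Odd i))
          ((p : ℤ) - ((p : ℤ) + q - (J.toList.map PNat.val).countP (fun i => Odd i)) / 2) : K) *
        (s + t) ^ (J.toList.map PNat.val).countP (fun i => Even i) *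
        (s * t) ^ ((p + q - (J.toList.map PNat.val).countP (fun i => Odd i)) / 2 -
          (J.toList.map PNat.val).countP (fun i => Even i))
      else 0 := by
  have h1 : convChar s t (X : K[X][X]) (C X) (YBasis s t J) =
      ((J.toList.map PNat.val).map (hyperbolicCoeff (algebraMap K K[X][X] (s + t))
        (algebraMap K K[X][X] (s * t)) X (C X))).prod := by
    rw [YBasis_apply, wordProd, map_list_prod, List.map_map, List.map_map]
    exact congrArg List.prod (List.map_congr_left fun n _ => convChar_Y s t _ _ n)
  have hpos : ∀ n ∈ J.toList.map PNat.val, 0 < n := by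
    intro n hn
    obtain ⟨k, -, rfl⟩ := List.mem_map.1 hn
    exact k.pos
  obtain ⟨e, he, hp⟩ := prod_hyperbolicCoeff (algebraMap K K[X][X] (s + t))
    (algebraMap K K[X][X] (s * t)) X (C X) _ hpos
  rw [h1, hp]
  generalize (J.toList.map PNat.val).countP (fun i => Odd i) = l at *
  generalize (J.toList.map PNat.val).countP (fun i => Even i) = l0 at *
  rw [← map_pow, ← map_pow, ← map_mul, Polynomial.algebraMap_apply, Polynomial.algebraMap_apply,
    Algebra.algebraMap_self_apply, coeff_mul_C, coeff_mul_C, coeff_add_pow_mul_pow, ← he]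
  by_cases h : p + q = l + 2 * (e + l0)
  -- Here $p+q-\ell_1=2(e+\ell_0)$, so the halving is exact and neither subtraction truncates.
  · rw [if_pos h, if_pos h.symm, show ((p : ℤ) + q - l) / 2 = ((e + l0 : ℕ) : ℤ) by omega,
      show (p + q - l) / 2 - l0 = e by omega]
    ring
  · rw [if_neg h, if_neg (Ne.symm h), zero_mul]

end NCSF

/-! ### Compositions as words -/

namespace QSym

theorem map_val_wordOf {n : ℕ} (I : Composition n) :
    (wordOf I).toList.map PNat.val = I.blocks := by
  rw [wordOf, FreeMonoid.toList_ofList, List.map_map]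
  refine (List.map_congr_left fun k hk => ?_).trans (List.map_id _)
  exact PNat.toPNat'_coe (I.blocks_pos hk)

theorem wordOf_injective {n : ℕ} : Function.Injective (wordOf (n := n)) := by
  intro I J h
  refine Composition.ext ?_
  rw [← map_val_wordOf, ← map_val_wordOf, h]

theorem exists_wordOf_eq {n : ℕ} {J : FreeMonoid ℕ+} (hJ : (J.toList.map PNat.val).sum = n) :
    ∃ I : Composition n, wordOf I = J := by
  refine ⟨⟨J.toList.map PNat.val, ?_, hJ⟩, ?_⟩
  · intro i hi
    obtain ⟨k, -, rfl⟩ := List.mem_map.1 hi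
    exact k.pos
  · refine FreeMonoid.toList.injective (List.map_injective_iff.2 PNat.coe_injective ?_)
    exact map_val_wordOf _

theorem wordOf_ones (p : ℕ) :
    wordOf (Composition.ones p) = FreeMonoid.ofList (List.replicate p 1) := by
  rw [wordOf, Composition.ones_blocks, List.map_replicate]
  rfl

end QSym

/-! ### Assembly of the product formula -/

namespace NCSF

open Polynomial in
-- As an identity of linear forms this can be checked on the $Y^J$, where multiplicativity gives the
-- values, and then evaluated at the $S^J$, which give the coefficients of quasi-symmetric
-- functions.
theorem coeff_convChar_eq_sum {K : Type*} [CommRing K] [Algebra ℚ K] (s t : K) (p q : ℕ) :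
    lcoeff K q ∘ₗ (lcoeff K[X] p).restrictScalars K ∘ₗ
      (convChar s t (X : K[X][X]) (C X)).toLinearMap =
      ∑ I : Composition (p + q),
        ((QSym.binom (QSym.oddParts I) ((p : ℤ) - ((p : ℤ) + q - QSym.oddParts I) / 2) : K) *
          (s + t) ^ QSym.evenParts I *
          (s * t) ^ ((p + q - QSym.oddParts I) / 2 - QSym.evenParts I)) •
        (YBasis s t).coord (QSym.wordOf I) := by
  classical
  refine (YBasis s t).ext fun J => ?_
  have hJ := coeff_convChar_YBasis s t p q J
  simp only [LinearMap.sum_apply, LinearMap.smul_apply, Basis.coord_apply, Basis.repr_self,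
    Finsupp.single_apply]
  refine Eq.trans hJ ?_
  split_ifs with h
  · obtain ⟨I, rfl⟩ := QSym.exists_wordOf_eq h
    rw [Finset.sum_eq_single I]
    · rw [if_pos rfl, smul_eq_mul, mul_one, QSym.map_val_wordOf]
      rfl
    · intro I' _ hI'
      rw [if_neg fun h' => hI' (QSym.wordOf_injective h').symm, smul_zero]
    · exact fun h' => absurd (Finset.mem_univ I) h'
  · refine (Finset.sum_eq_zero fun I _ => ?_).symm
    rw [if_neg, smul_zero]
    rintro rfl
    exact h (by rw [QSym.map_val_wordOf, I.blocks_sum])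

end NCSF

end

theorem mainTheorem4 {K : Type*} [CommRing K] [Algebra ℚ K] (s t : K) (p q : ℕ) :
    QSym.X s t (QSym.wordOf (Composition.ones p)) * QSym.X s t (QSym.wordOf (Composition.ones q)) =
      ∑ I : Composition (p + q),
        ((QSym.binom (QSym.oddParts I) ((p : ℤ) - ((p : ℤ) + q - QSym.oddParts I) / 2) : K) *
          (s + t) ^ QSym.evenParts I *
          (s * t) ^ ((p + q - QSym.oddParts I) / 2 - QSym.evenParts I)) •
        QSym.X s t (QSym.wordOf I) := by
  ext m
  rw [QSym.wordOf_ones, QSym.wordOf_ones, NCSF.coeff_X_replicate_mul, map_sum]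
  -- The coefficient of `X s t I` at `m` is by definition the $Y^I$-coordinate of the basis element
  -- $S^J$ with `J = exponentWord m`.
  refine Eq.trans (LinearMap.congr_fun (NCSF.coeff_convChar_eq_sum s t p q)
    (NCSF.SBasis K (QSym.exponentWord m))) ?_
  rw [LinearMap.sum_apply]
  rfl
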